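/- Let $\mathcal{H}=(M,S,X,\Delta)$ be a smooth hybrid dynamical system. That is: $M$ is a smooth finite-dimensional manifold (without boundary), $S\subset M$ is a smooth embedded submanifold of codimension $1$, $X$ is a smooth vector field on $M$, and $\Delta:S\to M$ is a smooth map with $S\cap\Delta(S)=\emptyset$ such that $\overline{S}\cap\overline{\Delta(S)}$ has codimension at least $2$ (it is empty or has Hausdorff dimension at most $\dim M-2$ in charts). The hybrid flow $(t,x)\mapsto\varphi^{\mathcal H}_t(x)$, $t\ge 0$, follows the flow of $X$ until the trajectory meets $S$; if this happens at the point $z\in S$ at time $t_1$, then $\varphi^{\mathcal H}_{t_1}(x)=z$, and immediately after $t_1$ the trajectory restarts from $\Delta(z)$; and so on. The hybrid flow is defined at $(t,x)$ if time $t$ is reached in this way after finitely many impacts. Smoothness of $\mathcal H$ means in addition that * if $\varphi^{\mathcal H}_t(x)\in\overline{S}\setminus S$, then there is $\varepsilon>0$ such that for all $0<\delta<\varepsilon$ the point $\varphi^{\mathcal H}_{t+\delta}(x)$ is defined and does not lie in $S$; * $T_xM=T_xS\oplus\mathbb{R}X(x)$ for all $x\in S$. Let $\Omega(M)=\bigoplus_k\Omega^k(M)$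 be the space of smooth differential forms on $M$. A form $\alpha\in\Omega(M)$ is called hybrid-invariant if $(\varphi^{\mathcal H}_t)^*\alpha=\alpha$ for all $t\ge 0$, that is, $\left((\varphi^{\mathcal H}_t)^*\alpha\right)_x=\alpha_x$ for all $t\geq 0$ and all $x\in M\setminus S$ with $\varphi^{\mathcal H}_t(x)\notin S$ that have an open neighborhood $U$ with $U\cap S=\emptyset$ on which $\varphi^{\mathcal H}_t$ is defined and smooth. Let $\mathscr{A}_{\mathcal H}\subset\Omega(M)$ be the set of hybrid-invariant forms. Then $\mathscr{A}_{\mathcal H}$ is a unital subalgebra of $\Omega(M)$ under the wedge product: it contains the constant function $1$, and $\alpha+\beta,\ c\,\alpha,\ \alpha\wedge\beta\in\mathscr{A}_{\mathcal H}$ for all $\alpha,\beta\in\mathscr{A}_{\mathcal H}$ and $c\in\mathbb{R}$. Moreover $d\alpha\in\mathscr{A}_{\mathcal H}$ and $i_X\alpha\in\mathscr{A}_{\mathcal H}$ for all $\alpha\in\mathscr{A}_{\mathcal H}$. -/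

import Mathlib

open Set Topology Module
open scoped Manifold ContDiff

noncomputable section

/-! ### Differential forms on a manifold without boundary -/

/-- The exterior product of a `k`-form and an `l`-form on a vector space `V`, as an `m`-form where
`k + l = m`. It is Mathlib's exterior product `AlternatingMap.domCoprod` (a signed sum over
`(k, l)`-shuffles), with values multiplied in `ℝ` and with arguments indexed by `Fin m`. -/
def wedge {V : Type*} [AddCommGroup V] [Module ℝ V] [TopologicalSpace V] {k l m : ℕ}
    (h : k + l = m) (a : V [⋀^Fin k]→L[ℝ] ℝ) (b : V [⋀^Fin l]→L[ℝ] ℝ) : V [⋀^Fin m]→L[ℝ] ℝ :=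
  { ((LinearMap.mul' ℝ ℝ).compAlternatingMap
      (a.toAlternatingMap.domCoprod b.toAlternatingMap)).domDomCongr
        (finSumFinEquiv.trans (finCongr h)) with
    cont := by
      change Continuous fun v : Fin m → V => LinearMap.mul' ℝ ℝ
        ((∑ σ : Equiv.Perm.ModSumCongr (Fin k) (Fin l),
          AlternatingMap.domCoprod.summand a.toAlternatingMap b.toAlternatingMap σ)
            fun i => v ((finSumFinEquiv.trans (finCongr h)) i))
      simp only [sum_apply, map_sum]
      refine continuous_finsetSum _ fun σ _ => ?_
      induction σ using Quotient.inductionOn' with | _ σ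
      have key : ∀ v : Fin m → V,
          LinearMap.mul' ℝ ℝ
            ((AlternatingMap.domCoprod.summand a.toAlternatingMap b.toAlternatingMap
              (Quotient.mk'' σ)) fun i => v ((finSumFinEquiv.trans (finCongr h)) i)) =
          Equiv.Perm.sign σ •
            (a (fun i => v ((finSumFinEquiv.trans (finCongr h)) (σ (Sum.inl i)))) *
              b (fun i => v ((finSumFinEquiv.trans (finCongr h)) (σ (Sum.inr i))))) := by
        intro v
        rw [AlternatingMap.domCoprod.summand_mk'', _root_.smul_apply, Units.smul_def,
          Units.smul_def, map_zsmul]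
        rfl
      simp only [key]
      refine Continuous.const_smul (Continuous.mul ?_ ?_) _
      · exact a.cont.comp (by fun_prop)
      · exact b.cont.comp (by fun_prop) }

section Forms

variable {E : Type*} [NormedAddCommGroup E] [NormedSpace ℝ E]
  {M : Type*} [TopologicalSpace M] [ChartedSpace E M]

variable (E M) in
/-- A (not necessarily smooth) form of degree `k`: an alternating `k`-linear form on every tangent
space. -/
abbrev KForm (k : ℕ) : Type _ :=
  ∀ x : M, TangentSpace 𝓘(ℝ, E) x [⋀^Fin k]→L[ℝ] ℝ

variable (E M) in
/-- A form of mixed degree, given by its homogeneous components. If `E` has dimension `n`, the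
components of degree `> n` vanish automatically, so this is the direct sum over all degrees. -/
abbrev MixedForm : Type _ := ∀ k : ℕ, KForm E M k

/-- The expression of a form in the chart at `x₀`: its pullback to an open set of `E` under the
inverse of the chart (only the values on the target of the chart are meaningful). -/
def KForm.inChart {k : ℕ} (η : KForm E M k) (x₀ : M) : E → E [⋀^Fin k]→L[ℝ] ℝ := fun y =>
  (η ((extChartAt 𝓘(ℝ, E) x₀).symm y)).compContinuousLinearMap
    (mfderiv 𝓘(ℝ, E) 𝓘(ℝ, E) (extChartAt 𝓘(ℝ, E) x₀).symm y)

/-- A form is smooth if its expression in each chart is `C^∞`. -/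
def KForm.IsSmooth {k : ℕ} (η : KForm E M k) : Prop :=
  ∀ x₀ : M, ContDiffOn ℝ ∞ (η.inChart x₀) (extChartAt 𝓘(ℝ, E) x₀).target

/-- The exterior derivative of a `k`-form, computed at `x` in the chart at `x`. -/
def KForm.d {k : ℕ} (η : KForm E M k) : KForm E M (k + 1) := fun x =>
  (extDeriv (η.inChart x) (extChartAt 𝓘(ℝ, E) x x)).compContinuousLinearMap
    (mfderiv 𝓘(ℝ, E) 𝓘(ℝ, E) (extChartAt 𝓘(ℝ, E) x) x)

/-- The contraction `(i_X η)(v₁, …, v_k) = η(X, v₁, …, v_k)`. -/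
def KForm.contract (X : ∀ x : M, TangentSpace 𝓘(ℝ, E) x) {k : ℕ} (η : KForm E M (k + 1)) :
    KForm E M k := fun x =>
  ContinuousAlternatingMap.curryLeft (E := E) (η x) (X x)

/-- The pullback of a form under a map which is differentiable at the points of interest. -/
def KForm.pullback (f : M → M) {k : ℕ} (η : KForm E M k) : KForm E M k := fun x =>
  (η (f x)).compContinuousLinearMap (mfderiv 𝓘(ℝ, E) 𝓘(ℝ, E) f x)

namespace MixedForm

variable (E M) in
/-- The space `Ω(M)` of smooth differential forms. -/
def smoothForms : Set (MixedForm E M) := {α | ∀ k, KForm.IsSmooth (α k)}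

/-- The unit for the exterior product: the function (`0`-form) `1`. -/
def one : MixedForm E M
  | 0 => fun _ => ContinuousAlternatingMap.constOfIsEmpty ℝ _ _ 1
  | _ + 1 => 0

/-- The exterior product of differential forms. -/
def wedge (α β : MixedForm E M) : MixedForm E M := fun m x =>
  ∑ p : Finset.HasAntidiagonal.antidiagonal m,
    _root_.wedge (Finset.HasAntidiagonal.mem_antidiagonal.mp p.2) (α p.1.1 x) (β p.1.2 x)

/-- The exterior derivative of differential forms. -/
def d (α : MixedForm E M) : MixedForm E M
  | 0 => 0
  | k + 1 => KForm.d (α k)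

/-- The contraction of differential forms with a vector field (it is zero on functions). -/
def contract (X : ∀ x : M, TangentSpace 𝓘(ℝ, E) x) (α : MixedForm E M) : MixedForm E M :=
  fun k => KForm.contract X (α (k + 1))

end MixedForm

end Forms

/-! ### Hybrid dynamical systems -/

/-- `Z` has codimension at least `c` in `M`: it is empty, or its Hausdorff dimension (computed in
charts) is at most `dim M - c`. For a submanifold this is the usual codimension. -/
def HasCodimAtLeast (E : Type*) [NormedAddCommGroup E] [NormedSpace ℝ E]
    {M : Type*} [TopologicalSpace M] [ChartedSpace E M] (c : ℕ) (Z : Set M) : Prop :=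
  ∀ x₀ : M, (Z ∩ (extChartAt 𝓘(ℝ, E) x₀).source).Nonempty →
    dimH (extChartAt 𝓘(ℝ, E) x₀ '' (Z ∩ (extChartAt 𝓘(ℝ, E) x₀).source)) + c ≤ finrank ℝ E

/-- A hybrid dynamical system `(M, S, X, Δ)` on a manifold `M` modelled on `E`, whose impact
surface `S` is an embedded submanifold of codimension one, modelled on `F`. -/
structure HybridSystem (E F M : Type*) [NormedAddCommGroup E] [NormedSpace ℝ E]
    [NormedAddCommGroup F] [NormedSpace ℝ F]
    [TopologicalSpace M] [ChartedSpace E M] [IsManifold 𝓘(ℝ, E) ∞ M] where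
  /-- The impact surface. -/
  S : Set M
  /-- The manifold structure of the impact surface. -/
  [chartedSpace : ChartedSpace F S]
  [isManifold : IsManifold 𝓘(ℝ, F) ∞ S]
  isSmoothEmbedding : Manifold.IsSmoothEmbedding 𝓘(ℝ, F) 𝓘(ℝ, E) ∞ (Subtype.val : S → M)
  codim_one : S.Nonempty → finrank ℝ F + 1 = finrank ℝ E
  /-- The continuous dynamics. -/
  X : ∀ x : M, TangentSpace 𝓘(ℝ, E) x
  smooth_X : ContMDiff 𝓘(ℝ, E) 𝓘(ℝ, E).tangent ∞ (fun x => (⟨x, X x⟩ : TangentBundle 𝓘(ℝ, E) M))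
  /-- The impact map. -/
  Δ : S → M
  smooth_Δ : ContMDiff 𝓘(ℝ, F) 𝓘(ℝ, E) ∞ Δ
  disjoint : Disjoint S (range Δ)
  codim_closure : HasCodimAtLeast E 2 (closure S ∩ closure (range Δ))

namespace HybridSystem

attribute [instance] HybridSystem.chartedSpace HybridSystem.isManifold

variable {E F M : Type*} [NormedAddCommGroup E] [NormedSpace ℝ E]
  [NormedAddCommGroup F] [NormedSpace ℝ F]
  [TopologicalSpace M] [ChartedSpace E M] [IsManifold 𝓘(ℝ, E) ∞ M]

/-- The flow of `X` carries `x` to `y` in time `t ≥ 0`, and the trajectory does not meet `S`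
at any time in `[0, t)`. -/
def FlowsTo (H : HybridSystem E F M) (x : M) (t : ℝ) (y : M) : Prop :=
  0 ≤ t ∧ ∃ (γ : ℝ → M) (a b : ℝ), a < 0 ∧ t < b ∧ IsMIntegralCurveOn γ H.X (Ioo a b) ∧
    γ 0 = x ∧ γ t = y ∧ ∀ s ∈ Ico 0 t, γ s ∉ H.S

/-- The hybrid trajectory starting at `x` is at `y` at time `t ≥ 0`. It follows the flow of `X`
until this meets `S`, at a point `z` and time `t` say; the trajectory is at `z` at the time `t` of
the impact, and just after time `t` it restarts at `Δ z`. Only finitely many impacts can occur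
before a given time, so a trajectory ends at a Zeno time. -/
inductive Reaches (H : HybridSystem E F M) : M → ℝ → M → Prop
  | flow {x : M} {t : ℝ} {y : M} : H.FlowsTo x t y → Reaches H x t y
  | impact {x : M} {t : ℝ} {z : H.S} {s : ℝ} {y : M} : H.FlowsTo x t z → 0 < s →
      Reaches H (H.Δ z) s y → Reaches H x (t + s) y

/-- The points at which the hybrid flow is defined at time `t`. -/
def flowDomain (H : HybridSystem E F M) (t : ℝ) : Set M := {x | ∃ y, H.Reaches x t y}

open Classical in
/-- The hybrid flow `φ_t` at time `t`. It is meaningful on `flowDomain t` only, and the position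
there is unique, see `Reaches.unique`. -/
def hybridFlow (H : HybridSystem E F M) (t : ℝ) (x : M) : M :=
  if h : ∃ y, H.Reaches x t y then h.choose else x

/-- A smooth hybrid system: (1) no trajectory enters `S` immediately after passing through a point
of `closure S \ S`; (2) `X` is transverse to `S`. -/
structure IsSmooth (H : HybridSystem E F M) : Prop where
  not_enter : ∀ (t : ℝ) (x : M), x ∈ H.flowDomain t → H.hybridFlow t x ∈ closure H.S \ H.S →
    ∃ ε > 0, ∀ δ, 0 < δ → δ < ε →
      x ∈ H.flowDomain (t + δ) ∧ H.hybridFlow (t + δ) x ∉ H.S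
  transverse : ∀ x : H.S,
    IsCompl (LinearMap.range (mfderiv 𝓘(ℝ, F) 𝓘(ℝ, E) (Subtype.val : H.S → M) x).toLinearMap)
      (Submodule.span ℝ {H.X x})

/-- The hybrid flow at time `t` is smooth near `x`, where neither `x` nor `φ_t(x)` lies
in `S`. -/
def IsRegularAt (H : HybridSystem E F M) (t : ℝ) (x : M) : Prop :=
  x ∉ H.S ∧ H.hybridFlow t x ∉ H.S ∧
    ∃ U : Set M, IsOpen U ∧ x ∈ U ∧ U ∩ H.S = ∅ ∧ U ⊆ H.flowDomain t ∧
      ContMDiffOn 𝓘(ℝ, E) 𝓘(ℝ, E) ∞ (H.hybridFlow t) U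

/-- The set of hybrid-invariant differential forms: the smooth forms `α` with `(φ_t)^* α = α`
for all times `t`, at every point near which `φ_t` is smooth, so that the pullback makes sense. -/
def invariantForms (H : HybridSystem E F M) : Set (MixedForm E M) :=
  {α | α ∈ MixedForm.smoothForms E M ∧
    ∀ (t : ℝ) (x : M), H.IsRegularAt t x → ∀ k, KForm.pullback (H.hybridFlow t) (α k) x = α k x}

section Unique

variable [T2Space M] {H : HybridSystem E F M}

theorem integralCurve_unique {γ γ' : ℝ → M} {a b a' b' s : ℝ}
    (hγ : IsMIntegralCurveOn γ H.X (Ioo a b)) (hγ' : IsMIntegralCurveOn γ' H.X (Ioo a' b'))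
    (ha : a < 0) (ha' : a' < 0) (hb : s < b) (hb' : s < b') (h0 : γ 0 = γ' 0) (hs : 0 ≤ s) :
    γ s = γ' s := by
  have : IsManifold 𝓘(ℝ, E) 1 M := IsManifold.of_le (n := ∞) (by norm_num)
  have h1 : Ioo (max a a') (min b b') ⊆ Ioo a b :=
    Ioo_subset_Ioo (le_max_left _ _) (min_le_left _ _)
  have h2 : Ioo (max a a') (min b b') ⊆ Ioo a' b' :=
    Ioo_subset_Ioo (le_max_right _ _) (min_le_right _ _)
  exact isMIntegralCurveOn_Ioo_eqOn_of_contMDiff_boundaryless (t₀ := 0)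
    ⟨max_lt ha ha', lt_min (hs.trans_lt hb) (hs.trans_lt hb')⟩
    (H.smooth_X.of_le (by norm_num)) (hγ.mono h1) (hγ'.mono h2) h0
    ⟨(max_lt ha ha').trans_le hs, lt_min hb hb'⟩

theorem FlowsTo.unique {x y y' : M} {t : ℝ} (h : H.FlowsTo x t y) (h' : H.FlowsTo x t y') :
    y = y' := by
  obtain ⟨ht, γ, a, b, ha, hb, hγ, h0, rfl, -⟩ := h
  obtain ⟨-, γ', a', b', ha', hb', hγ', h0', rfl, -⟩ := h'
  exact integralCurve_unique hγ hγ' ha ha' hb hb' (h0.trans h0'.symm) ht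

/-- The first impact occurs at a well-defined time. -/
theorem FlowsTo.le_of_mem {x y y' : M} {t t' : ℝ} (h : H.FlowsTo x t y) (hy : y ∈ H.S)
    (h' : H.FlowsTo x t' y') : t' ≤ t := by
  obtain ⟨ht, γ, a, b, ha, hb, hγ, h0, rfl, -⟩ := h
  obtain ⟨-, γ', a', b', ha', hb', hγ', h0', rfl, h''⟩ := h'
  by_contra! hlt
  refine h'' t ⟨ht, hlt⟩ ?_
  rwa [← integralCurve_unique hγ hγ' ha ha' hb (hlt.trans hb') (h0.trans h0'.symm) ht]

/-- The position of a hybrid trajectory at a given time is unique. -/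
theorem Reaches.unique {x y y' : M} {t : ℝ} (h : H.Reaches x t y) (h' : H.Reaches x t y') :
    y = y' := by
  induction h generalizing y' with
  | flow h =>
    cases h' with
    | flow h' => exact h.unique h'
    | impact h' hs _ =>
      have := h'.le_of_mem (Subtype.coe_prop _) h
      linarith
  | @impact x t z s y h hs hr ih =>
    generalize hT : t + s = T at h'
    cases h' with
    | flow h' =>
      have := h.le_of_mem z.2 h'
      linarith
    | @impact _ t' z' s' _ h' hs' hr' =>
      obtain rfl : t = t' := le_antisymm (h'.le_of_mem z'.2 h) (h.le_of_mem z.2 h')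
      obtain rfl : z = z' := Subtype.ext (h.unique h')
      obtain rfl : s = s' := by linarith
      exact ih hr'

theorem Reaches.hybridFlow_eq {x y : M} {t : ℝ} (h : H.Reaches x t y) : H.hybridFlow t x = y := by
  have hex : ∃ y, H.Reaches x t y := ⟨y, h⟩
  rw [hybridFlow, dif_pos hex]
  exact hex.choose_spec.unique h

end Unique

end HybridSystem

end

/-! Invariance is an identity of alternating forms at each regular point, and pullback is linear and
multiplicative. So the unit, sums, scalar multiples and exterior products need only pointwise
algebra.

The exterior derivative needs the identity near a regular point `x`, not just at it. Since `S` need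
not be closed, points `z` near `x` may be mapped into `S`, where invariance is not assumed. They
have empty interior: if `φ_t` mapped a whole open set disjoint from `S` into `S`, moving the initial
point along `X` would keep one trajectory in `S` during a time interval, which
`Reaches.exists_not_mem` forbids. Continuity then extends the identity to all nearby points
(`IsRegularAt.eventually_pullback_eq`), and naturality of `d` (`KForm.d_pullback_at`) finishes.

For the contraction, `X` must be carried to itself by `φ_t` (`IsRegularAt.mapDeriv_hybridFlow_X`).
If `c` is the integral curve from `x`, then `φ_t (c s)` is the position of `x` at time `t + s`. As
`φ_t(x)` is outside `S`, this is the integral curve from `φ_t(x)` for small `s ≥ 0`; differentiating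
at `0` gives the claim. -/

/-! ### The exterior product as a sum over shuffles, and its pullback. -/

theorem wedge_apply {V : Type*} [AddCommGroup V] [Module ℝ V] [TopologicalSpace V] {k l m : ℕ}
    (h : k + l = m) (a : V [⋀^Fin k]→L[ℝ] ℝ) (b : V [⋀^Fin l]→L[ℝ] ℝ) (v : Fin m → V) :
    wedge h a b v = ∑ σ : Equiv.Perm.ModSumCongr (Fin k) (Fin l),
      LinearMap.mul' ℝ ℝ (AlternatingMap.domCoprod.summand a.toAlternatingMap b.toAlternatingMap σ
        fun i => v ((finSumFinEquiv.trans (finCongr h)) i)) := by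
  change LinearMap.mul' ℝ ℝ
        ((∑ σ : Equiv.Perm.ModSumCongr (Fin k) (Fin l),
          AlternatingMap.domCoprod.summand a.toAlternatingMap b.toAlternatingMap σ)
            fun i => v ((finSumFinEquiv.trans (finCongr h)) i)) = _
  simp only [sum_apply, map_sum]

theorem mul'_domCoprod_summand_mk {V : Type*} [AddCommGroup V] [Module ℝ V] [TopologicalSpace V]
    {k l : ℕ} (a : V [⋀^Fin k]→L[ℝ] ℝ) (b : V [⋀^Fin l]→L[ℝ] ℝ)
    (σ : Equiv.Perm (Fin k ⊕ Fin l)) (v : Fin k ⊕ Fin l → V) :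
    LinearMap.mul' ℝ ℝ (AlternatingMap.domCoprod.summand a.toAlternatingMap b.toAlternatingMap
        (Quotient.mk'' σ) v) =
      Equiv.Perm.sign σ • (a (fun i => v (σ (Sum.inl i))) * b (fun i => v (σ (Sum.inr i)))) := by
  rw [AlternatingMap.domCoprod.summand_mk'', _root_.smul_apply, Units.smul_def,
    Units.smul_def, map_zsmul]
  rfl

theorem wedge_compContinuousLinearMap {V W : Type*} [AddCommGroup V] [Module ℝ V]
    [TopologicalSpace V] [AddCommGroup W] [Module ℝ W] [TopologicalSpace W] {k l m : ℕ}
    (h : k + l = m) (a : V [⋀^Fin k]→L[ℝ] ℝ) (b : V [⋀^Fin l]→L[ℝ] ℝ) (A : W →L[ℝ] V) :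
    (wedge h a b).compContinuousLinearMap A =
      wedge h (a.compContinuousLinearMap A) (b.compContinuousLinearMap A) := by
  ext v
  rw [ContinuousAlternatingMap.compContinuousLinearMap_apply, wedge_apply, wedge_apply]
  refine Finset.sum_congr rfl fun σ _ => ?_
  induction σ using Quotient.inductionOn' with | _ σ
  rw [mul'_domCoprod_summand_mk, mul'_domCoprod_summand_mk]
  rfl

/-! ### Smoothness of form-valued maps on a vector space. -/

section Smooth

variable {E G : Type*} [NormedAddCommGroup E] [NormedSpace ℝ E]
  [NormedAddCommGroup G] [NormedSpace ℝ G]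
  {n : WithTop ℕ∞} {s : Set G} {k l m : ℕ}

/-- An alternating map is determined by its values on basis tuples, so evaluation on them is
injective and splits; the splitting is continuous because its source is finite-dimensional. It
reduces smoothness of a form-valued map to that of its components. -/
theorem exists_leftInverse_evalBasis (E : Type*) [NormedAddCommGroup E] [NormedSpace ℝ E]
    [FiniteDimensional ℝ E] (k : ℕ) :
    ∃ L : ((Fin k → Fin (finrank ℝ E)) → ℝ) →L[ℝ] E [⋀^Fin k]→L[ℝ] ℝ,
      ∀ a : E [⋀^Fin k]→L[ℝ] ℝ, L (fun c => a fun i => finBasis ℝ E (c i)) = a := by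
  let ev : (E [⋀^Fin k]→L[ℝ] ℝ) →ₗ[ℝ] ((Fin k → Fin (finrank ℝ E)) → ℝ) :=
    { toFun := fun a c => a fun i => finBasis ℝ E (c i)
      map_add' := fun _ _ => rfl
      map_smul' := fun _ _ => rfl }
  have hinj : Function.Injective ev := by
    intro a b hab
    apply ContinuousAlternatingMap.toAlternatingMap_injective
    exact Basis.ext_alternating (finBasis ℝ E) fun v _ => congrFun hab v
  obtain ⟨g, hg⟩ := LinearMap.exists_leftInverse_of_injective ev (LinearMap.ker_eq_bot.2 hinj)
  exact ⟨LinearMap.toContinuousLinearMap g, fun a => LinearMap.congr_fun hg a⟩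

theorem ContDiffOn.continuousAlternatingMap_apply {f : G → E [⋀^Fin k]→L[ℝ] ℝ}
    (hf : ContDiffOn ℝ n f s) (v : Fin k → E) : ContDiffOn ℝ n (fun y => f y v) s :=
  (ContinuousAlternatingMap.apply ℝ E ℝ v).contDiff.comp_contDiffOn hf

theorem contDiffOn_continuousAlternatingMap_of_apply [FiniteDimensional ℝ E]
    {f : G → E [⋀^Fin k]→L[ℝ] ℝ} (hf : ∀ v, ContDiffOn ℝ n (fun y => f y v) s) :
    ContDiffOn ℝ n f s := by
  obtain ⟨L, hL⟩ := exists_leftInverse_evalBasis E k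
  have : f = fun y => L (fun c => f y fun i => finBasis ℝ E (c i)) := funext fun y => (hL _).symm
  rw [this]
  exact L.contDiff.comp_contDiffOn (contDiffOn_pi.2 fun c => hf _)

theorem ContDiffOn.wedge [FiniteDimensional ℝ E] (h : k + l = m)
    {f : G → E [⋀^Fin k]→L[ℝ] ℝ} {g : G → E [⋀^Fin l]→L[ℝ] ℝ}
    (hf : ContDiffOn ℝ n f s) (hg : ContDiffOn ℝ n g s) :
    ContDiffOn ℝ n (fun y => wedge h (f y) (g y)) s := by
  refine contDiffOn_continuousAlternatingMap_of_apply fun v => ?_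
  simp only [wedge_apply]
  refine ContDiffOn.sum fun σ _ => ?_
  induction σ using Quotient.inductionOn' with | _ σ
  simp only [mul'_domCoprod_summand_mk, Units.smul_def, zsmul_eq_mul]
  exact contDiffOn_const.mul
    ((hf.continuousAlternatingMap_apply _).mul (hg.continuousAlternatingMap_apply _))

theorem ContDiffOn.curryLeft_apply [FiniteDimensional ℝ E]
    {f : G → E [⋀^Fin (k + 1)]→L[ℝ] ℝ} {X : G → E}
    (hf : ContDiffOn ℝ n f s) (hX : ContDiffOn ℝ n X s) :
    ContDiffOn ℝ n (fun y => (f y).curryLeft (X y)) s := by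
  refine contDiffOn_continuousAlternatingMap_of_apply fun v => ?_
  -- Expanding `X y` in a basis leaves only scalar functions and evaluations of `f` at fixed
  -- vectors.
  have h : ∀ y, (f y).curryLeft (X y) v =
      ∑ i, (finBasis ℝ E).coord i (X y) * f y (Matrix.vecCons (finBasis ℝ E i) v) := by
    intro y
    conv_lhs => rw [← (finBasis ℝ E).sum_repr (X y), map_sum]
    simp only [map_smul, Basis.coord_apply]
    rw [ContinuousAlternatingMap.sum_apply]
    rfl
  simp only [h]
  exact ContDiffOn.sum fun i _ =>
    ((LinearMap.toContinuousLinearMap ((finBasis ℝ E).coord i)).contDiff.comp_contDiffOn hX).mul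
      (hf.continuousAlternatingMap_apply _)

theorem ContDiffOn.extDeriv {f : E → E [⋀^Fin k]→L[ℝ] ℝ} {s : Set E} (hs : IsOpen s)
    (hf : ContDiffOn ℝ ∞ f s) : ContDiffOn ℝ ∞ (extDeriv f) s :=
  (ContinuousAlternatingMap.alternatizeUncurryFinCLM ℝ E ℝ).contDiff.comp_contDiffOn
    (hf.fderiv_of_isOpen hs le_rfl)

end Smooth

/-! ### Forms and maps in charts, and naturality of the exterior derivative. -/

section ChartExpression

variable {E : Type*} [NormedAddCommGroup E] [NormedSpace ℝ E]
  {M : Type*} [TopologicalSpace M] [ChartedSpace E M]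

/-- The derivative of a chart, as an endomorphism of the model space. -/
noncomputable def chartDeriv (x₀ x : M) : E →L[ℝ] E :=
  mfderiv 𝓘(ℝ, E) 𝓘(ℝ, E) (extChartAt 𝓘(ℝ, E) x₀) x

/-- The derivative of the inverse of a chart, as an endomorphism of the model space. -/
noncomputable def chartSymmDeriv (x₀ : M) (y : E) : E →L[ℝ] E :=
  mfderiv 𝓘(ℝ, E) 𝓘(ℝ, E) (extChartAt 𝓘(ℝ, E) x₀).symm y

/-- The derivative of a self-map, as an endomorphism of the model space. -/
noncomputable def mapDeriv (f : M → M) (x : M) : E →L[ℝ] E :=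
  mfderiv 𝓘(ℝ, E) 𝓘(ℝ, E) f x

/-- A form at a point, as an alternating map on the model space. -/
def KForm.at {k : ℕ} (η : KForm E M k) (x : M) : E [⋀^Fin k]→L[ℝ] ℝ := η x

/-- A tangent vector field at a point, as a vector of the model space. -/
def vectorAt (X : ∀ x : M, TangentSpace 𝓘(ℝ, E) x) (x : M) : E := X x

/-- The expression of a self-map in the charts at two points. -/
noncomputable def mapInCharts (E : Type*) [NormedAddCommGroup E] [NormedSpace ℝ E] {M : Type*}
    [TopologicalSpace M] [ChartedSpace E M] (f : M → M) (x₀ y₀ : M) : E → E :=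
  extChartAt 𝓘(ℝ, E) y₀ ∘ f ∘ (extChartAt 𝓘(ℝ, E) x₀).symm

variable {k : ℕ} {η : KForm E M k} {f : M → M} {x₀ y₀ x : M} {y : E}

/-- Every tangent space is `E` by definition. Stating the basic formulas over `E` itself lets
rewriting proceed without types that depend on the base point. -/
theorem KForm.inChart_eq (η : KForm E M k) (x₀ : M) (y : E) :
    η.inChart x₀ y = (η.at ((extChartAt 𝓘(ℝ, E) x₀).symm y)).compContinuousLinearMap
      (chartSymmDeriv x₀ y) := rfl

theorem KForm.pullback_at (f : M → M) (η : KForm E M k) (x : M) :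
    (η.pullback f).at x = (η.at (f x)).compContinuousLinearMap (mapDeriv f x) := rfl

theorem KForm.d_at (η : KForm E M k) (x : M) :
    η.d.at x = (extDeriv (η.inChart x) (extChartAt 𝓘(ℝ, E) x x)).compContinuousLinearMap
      (chartDeriv x x) := rfl

variable [IsManifold 𝓘(ℝ, E) ∞ M]

omit [IsManifold 𝓘(ℝ, E) ∞ M] in
theorem extChartAt_target_mem_nhds_of_mem (hy : y ∈ (extChartAt 𝓘(ℝ, E) x₀).target) :
    (extChartAt 𝓘(ℝ, E) x₀).target ∈ 𝓝 y :=
  (isOpen_extChartAt_target x₀).mem_nhds hy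

theorem contMDiffAt_extChartAt_symm_of_mem (hy : y ∈ (extChartAt 𝓘(ℝ, E) x₀).target) :
    ContMDiffAt 𝓘(ℝ, E) 𝓘(ℝ, E) ∞ (extChartAt 𝓘(ℝ, E) x₀).symm y :=
  (contMDiffOn_extChartAt_symm x₀).contMDiffAt (extChartAt_target_mem_nhds_of_mem hy)

theorem contMDiffAt_extChartAt_of_mem (hx : x ∈ (extChartAt 𝓘(ℝ, E) x₀).source) :
    ContMDiffAt 𝓘(ℝ, E) 𝓘(ℝ, E) ∞ (extChartAt 𝓘(ℝ, E) x₀) x :=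
  contMDiffAt_extChartAt' (by rwa [← extChartAt_source 𝓘(ℝ, E)])

theorem chartDeriv_chartSymmDeriv (hx : x ∈ (extChartAt 𝓘(ℝ, E) x₀).source) (v : E) :
    chartDeriv x₀ x (chartSymmDeriv x₀ (extChartAt 𝓘(ℝ, E) x₀ x) v) = v := by
  have hy := (extChartAt 𝓘(ℝ, E) x₀).map_source hx
  have h := mfderiv_comp_apply_of_eq (x := extChartAt 𝓘(ℝ, E) x₀ x) (y := x)
    ((contMDiffAt_extChartAt_of_mem hx).mdifferentiableAt (by simp))
    ((contMDiffAt_extChartAt_symm_of_mem hy).mdifferentiableAt (by simp))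
    ((extChartAt 𝓘(ℝ, E) x₀).left_inv hx) v
  refine h.symm.trans ?_
  have he : extChartAt 𝓘(ℝ, E) x₀ ∘ (extChartAt 𝓘(ℝ, E) x₀).symm
      =ᶠ[𝓝 (extChartAt 𝓘(ℝ, E) x₀ x)] id := by
    filter_upwards [extChartAt_target_mem_nhds_of_mem hy] with z hz
    exact (extChartAt 𝓘(ℝ, E) x₀).right_inv hz
  rw [he.mfderiv_eq, mfderiv_id]
  rfl

theorem chartSymmDeriv_chartDeriv (hx : x ∈ (extChartAt 𝓘(ℝ, E) x₀).source) (v : E) :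
    chartSymmDeriv x₀ (extChartAt 𝓘(ℝ, E) x₀ x) (chartDeriv x₀ x v) = v := by
  have hy := (extChartAt 𝓘(ℝ, E) x₀).map_source hx
  have h := mfderiv_comp_apply (x := x)
    ((contMDiffAt_extChartAt_symm_of_mem hy).mdifferentiableAt (by simp))
    ((contMDiffAt_extChartAt_of_mem hx).mdifferentiableAt (by simp)) v
  refine h.symm.trans ?_
  have he : (extChartAt 𝓘(ℝ, E) x₀).symm ∘ extChartAt 𝓘(ℝ, E) x₀ =ᶠ[𝓝 x] id := by
    filter_upwards [extChartAt_source_mem_nhds' hx] with z hz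
    exact (extChartAt 𝓘(ℝ, E) x₀).left_inv hz
  rw [he.mfderiv_eq, mfderiv_id]
  rfl

theorem KForm.at_eq_inChart (η : KForm E M k) (hx : x ∈ (extChartAt 𝓘(ℝ, E) x₀).source) :
    η.at x = (η.inChart x₀ (extChartAt 𝓘(ℝ, E) x₀ x)).compContinuousLinearMap
      (chartDeriv x₀ x) := by
  ext v
  rw [KForm.inChart_eq, (extChartAt 𝓘(ℝ, E) x₀).left_inv hx]
  simp only [ContinuousAlternatingMap.compContinuousLinearMap_apply, Function.comp_def,
    chartSymmDeriv_chartDeriv hx]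

theorem contDiffAt_mapInCharts (hy : y ∈ (extChartAt 𝓘(ℝ, E) x₀).target)
    (hf : ContMDiffAt 𝓘(ℝ, E) 𝓘(ℝ, E) ∞ f ((extChartAt 𝓘(ℝ, E) x₀).symm y))
    (hfy : f ((extChartAt 𝓘(ℝ, E) x₀).symm y) ∈ (extChartAt 𝓘(ℝ, E) y₀).source) :
    ContDiffAt ℝ ∞ (mapInCharts E f x₀ y₀) y :=
  ((contMDiffAt_extChartAt_of_mem hfy).comp y
    (hf.comp y (contMDiffAt_extChartAt_symm_of_mem hy))).contDiffAt

theorem chartSymmDeriv_fderiv_mapInCharts (hy : y ∈ (extChartAt 𝓘(ℝ, E) x₀).target)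
    (hf : ContMDiffAt 𝓘(ℝ, E) 𝓘(ℝ, E) ∞ f ((extChartAt 𝓘(ℝ, E) x₀).symm y))
    (hfy : f ((extChartAt 𝓘(ℝ, E) x₀).symm y) ∈ (extChartAt 𝓘(ℝ, E) y₀).source) (v : E) :
    chartSymmDeriv y₀ (mapInCharts E f x₀ y₀ y) (fderiv ℝ (mapInCharts E f x₀ y₀) y v) =
      mapDeriv f ((extChartAt 𝓘(ℝ, E) x₀).symm y) (chartSymmDeriv x₀ y v) := by
  have hs := contMDiffAt_extChartAt_symm_of_mem hy
  have hg := (contDiffAt_mapInCharts hy hf hfy).contMDiffAt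
  have hy' : mapInCharts E f x₀ y₀ y ∈ (extChartAt 𝓘(ℝ, E) y₀).target :=
    (extChartAt 𝓘(ℝ, E) y₀).map_source hfy
  have h1 := mfderiv_comp_apply (x := y)
    ((contMDiffAt_extChartAt_symm_of_mem hy').mdifferentiableAt (by simp))
    (hg.mdifferentiableAt (by simp)) v
  have h2 := mfderiv_comp_apply (x := y) (hf.mdifferentiableAt (by simp))
    (hs.mdifferentiableAt (by simp)) v
  -- This identity near `y`, differentiated on both sides, is the claim.
  have he : (extChartAt 𝓘(ℝ, E) y₀).symm ∘ mapInCharts E f x₀ y₀ =ᶠ[𝓝 y]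
      f ∘ (extChartAt 𝓘(ℝ, E) x₀).symm := by
    filter_upwards [(hf.comp y hs).continuousAt.preimage_mem_nhds
      (extChartAt_source_mem_nhds' hfy)] with z hz
    exact (extChartAt 𝓘(ℝ, E) y₀).left_inv hz
  rw [mfderiv_eq_fderiv] at h1
  exact h1.symm.trans ((congrArg (fun A : E →L[ℝ] E => A v) he.mfderiv_eq).trans h2)

theorem chartDeriv_mapDeriv (hx : x ∈ (extChartAt 𝓘(ℝ, E) x₀).source)
    (hf : ContMDiffAt 𝓘(ℝ, E) 𝓘(ℝ, E) ∞ f x)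
    (hfx : f x ∈ (extChartAt 𝓘(ℝ, E) y₀).source) (v : E) :
    fderiv ℝ (mapInCharts E f x₀ y₀) (extChartAt 𝓘(ℝ, E) x₀ x) (chartDeriv x₀ x v) =
      chartDeriv y₀ (f x) (mapDeriv f x v) := by
  have hl := (extChartAt 𝓘(ℝ, E) x₀).left_inv hx
  have hy := (extChartAt 𝓘(ℝ, E) x₀).map_source hx
  have h := chartSymmDeriv_fderiv_mapInCharts (f := f) (y₀ := y₀) hy (by rwa [hl]) (by rwa [hl])
    (chartDeriv x₀ x v)
  rw [hl, chartSymmDeriv_chartDeriv hx] at h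
  rw [← h, mapInCharts, Function.comp_apply, Function.comp_apply, hl,
    chartDeriv_chartSymmDeriv hfx]

/-- Turns pullback on `M` into pullback under a map between open sets of `E`, where the Euclidean
formula for `extDeriv` applies. -/
theorem KForm.inChart_pullback (η : KForm E M k) (hy : y ∈ (extChartAt 𝓘(ℝ, E) x₀).target)
    (hf : ContMDiffAt 𝓘(ℝ, E) 𝓘(ℝ, E) ∞ f ((extChartAt 𝓘(ℝ, E) x₀).symm y))
    (hfy : f ((extChartAt 𝓘(ℝ, E) x₀).symm y) ∈ (extChartAt 𝓘(ℝ, E) y₀).source) :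
    (η.pullback f).inChart x₀ y =
      (η.inChart y₀ (mapInCharts E f x₀ y₀ y)).compContinuousLinearMap
        (fderiv ℝ (mapInCharts E f x₀ y₀) y) := by
  ext v
  rw [KForm.inChart_eq, KForm.inChart_eq, KForm.pullback_at]
  simp only [ContinuousAlternatingMap.compContinuousLinearMap_apply, Function.comp_def,
    chartSymmDeriv_fderiv_mapInCharts hy hf hfy]
  simp only [mapInCharts, Function.comp_apply, (extChartAt 𝓘(ℝ, E) y₀).left_inv hfy]

omit [IsManifold 𝓘(ℝ, E) ∞ M] in
theorem KForm.pullback_id (η : KForm E M k) : η.pullback id = η := by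
  funext x
  change (η x).compContinuousLinearMap (mfderiv 𝓘(ℝ, E) 𝓘(ℝ, E) id x) = η x
  rw [mfderiv_id]
  rfl

theorem eventually_mem_charts_and_contMDiffAt (hf : ∀ᶠ z in 𝓝 x, ContMDiffAt 𝓘(ℝ, E) 𝓘(ℝ, E) ∞ f z)
    (hx : x ∈ (extChartAt 𝓘(ℝ, E) x₀).source) (hfx : f x ∈ (extChartAt 𝓘(ℝ, E) y₀).source) :
    ∀ᶠ y in 𝓝 (extChartAt 𝓘(ℝ, E) x₀ x), y ∈ (extChartAt 𝓘(ℝ, E) x₀).target ∧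
      ContMDiffAt 𝓘(ℝ, E) 𝓘(ℝ, E) ∞ f ((extChartAt 𝓘(ℝ, E) x₀).symm y) ∧
      f ((extChartAt 𝓘(ℝ, E) x₀).symm y) ∈ (extChartAt 𝓘(ℝ, E) y₀).source := by
  have hy := (extChartAt 𝓘(ℝ, E) x₀).map_source hx
  have hc : Filter.Tendsto (extChartAt 𝓘(ℝ, E) x₀).symm (𝓝 (extChartAt 𝓘(ℝ, E) x₀ x)) (𝓝 x) := by
    have := (contMDiffAt_extChartAt_symm_of_mem hy).continuousAt
    rwa [ContinuousAt, (extChartAt 𝓘(ℝ, E) x₀).left_inv hx] at this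
  filter_upwards [extChartAt_target_mem_nhds_of_mem hy, hc.eventually hf,
    hc.eventually (hf.self_of_nhds.continuousAt.preimage_mem_nhds
      (extChartAt_source_mem_nhds' hfx))] with z h1 h2 h3
  exact ⟨h1, h2, h3⟩

/-- The exterior derivative commutes with pullback, and can be computed in any chart. -/
theorem KForm.extDeriv_inChart_pullback (hη : η.IsSmooth)
    (hf : ∀ᶠ z in 𝓝 x, ContMDiffAt 𝓘(ℝ, E) 𝓘(ℝ, E) ∞ f z)
    (hx : x ∈ (extChartAt 𝓘(ℝ, E) x₀).source) (hfx : f x ∈ (extChartAt 𝓘(ℝ, E) y₀).source) :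
    (extDeriv ((η.pullback f).inChart x₀)
        (extChartAt 𝓘(ℝ, E) x₀ x)).compContinuousLinearMap (chartDeriv x₀ x) =
      ((extDeriv (η.inChart y₀) (extChartAt 𝓘(ℝ, E) y₀ (f x))).compContinuousLinearMap
        (chartDeriv y₀ (f x))).compContinuousLinearMap (mapDeriv f x) := by
  have hev := eventually_mem_charts_and_contMDiffAt hf hx hfx
  have he : (η.pullback f).inChart x₀ =ᶠ[𝓝 (extChartAt 𝓘(ℝ, E) x₀ x)] fun y =>
      (η.inChart y₀ (mapInCharts E f x₀ y₀ y)).compContinuousLinearMap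
        (fderiv ℝ (mapInCharts E f x₀ y₀) y) := by
    filter_upwards [hev] with y hy
    exact η.inChart_pullback hy.1 hy.2.1 hy.2.2
  have hg : mapInCharts E f x₀ y₀ (extChartAt 𝓘(ℝ, E) x₀ x) = extChartAt 𝓘(ℝ, E) y₀ (f x) := by
    rw [mapInCharts, Function.comp_apply, Function.comp_apply,
      (extChartAt 𝓘(ℝ, E) x₀).left_inv hx]
  obtain ⟨h1, h2, h3⟩ := hev.self_of_nhds
  have hd : DifferentiableAt ℝ (η.inChart y₀)
      (mapInCharts E f x₀ y₀ (extChartAt 𝓘(ℝ, E) x₀ x)) := by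
    rw [hg]
    exact ((hη y₀).contDiffAt (extChartAt_target_mem_nhds_of_mem
      ((extChartAt 𝓘(ℝ, E) y₀).map_source hfx))).differentiableAt (by simp)
  -- `extDeriv` sees only the germ, so `he` suffices; the Euclidean formula asks that the map be
  -- `C^2`.
  rw [he.extDeriv_eq, extDeriv_pullback hd (contDiffAt_mapInCharts h1 h2 h3)
    (by simp only [minSmoothness_of_isRCLikeNormedField]; exact WithTop.coe_le_coe.2 (le_top : (2 : ℕ∞) ≤ ⊤)), hg]
  ext v
  simp only [ContinuousAlternatingMap.compContinuousLinearMap_apply, Function.comp_def,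
    chartDeriv_mapDeriv hx hf.self_of_nhds hfx]

/-- Independence of the chart is naturality of `d` for the identity map, read in two different
charts. -/
theorem KForm.d_at_eq (hη : η.IsSmooth) (hx : x ∈ (extChartAt 𝓘(ℝ, E) x₀).source) :
    η.d.at x = (extDeriv (η.inChart x₀) (extChartAt 𝓘(ℝ, E) x₀ x)).compContinuousLinearMap
      (chartDeriv x₀ x) := by
  have h := KForm.extDeriv_inChart_pullback (f := id) (x₀ := x) (y₀ := x₀) hη
    (Filter.Eventually.of_forall fun _ => contMDiffAt_id) (mem_extChartAt_source x) hx
  rw [KForm.pullback_id] at h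
  rw [KForm.d_at, h]
  ext v
  have : ∀ w : E, mapDeriv (id : M → M) x w = w := fun w => by
    rw [mapDeriv, mfderiv_id]; rfl
  simp only [ContinuousAlternatingMap.compContinuousLinearMap_apply, Function.comp_def, this, id]

theorem KForm.d_pullback_at (hη : η.IsSmooth)
    (hf : ∀ᶠ z in 𝓝 x, ContMDiffAt 𝓘(ℝ, E) 𝓘(ℝ, E) ∞ f z) :
    (η.pullback f).d.at x = (η.d.pullback f).at x := by
  rw [KForm.pullback_at, KForm.d_at, KForm.d_at, KForm.extDeriv_inChart_pullback hη hf
    (mem_extChartAt_source x) (mem_extChartAt_source (f x))]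

theorem KForm.d_congr {η' : KForm E M k} (h : ∀ᶠ z in 𝓝 x, η z = η' z) : η.d x = η'.d x := by
  have hc : Filter.Tendsto (extChartAt 𝓘(ℝ, E) x).symm (𝓝 (extChartAt 𝓘(ℝ, E) x x)) (𝓝 x) := by
    have := (contMDiffAt_extChartAt_symm_of_mem (mem_extChartAt_target (I := 𝓘(ℝ, E)) x)).continuousAt
    rwa [ContinuousAt, extChartAt_to_inv] at this
  have he : η.inChart x =ᶠ[𝓝 (extChartAt 𝓘(ℝ, E) x x)] η'.inChart x := by
    filter_upwards [hc.eventually h] with y hy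
    rw [KForm.inChart, hy, KForm.inChart]
  rw [KForm.d, he.extDeriv_eq, KForm.d]

theorem KForm.inChart_d (hη : η.IsSmooth) (hy : y ∈ (extChartAt 𝓘(ℝ, E) x₀).target) :
    η.d.inChart x₀ y = extDeriv (η.inChart x₀) y := by
  have hx := (extChartAt 𝓘(ℝ, E) x₀).map_target hy
  have hr := (extChartAt 𝓘(ℝ, E) x₀).right_inv hy
  rw [KForm.inChart_eq, KForm.d_at_eq hη hx, hr]
  have h := chartDeriv_chartSymmDeriv hx
  rw [hr] at h
  ext v
  simp only [ContinuousAlternatingMap.compContinuousLinearMap_apply, Function.comp_def, h]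

theorem KForm.IsSmooth.d (hη : η.IsSmooth) : η.d.IsSmooth := fun x₀ =>
  ((hη x₀).extDeriv (isOpen_extChartAt_target x₀)).congr fun _ hy => KForm.inChart_d hη hy

/-- A smooth form which agrees with its pullback at points arbitrarily near `x` agrees with it
at `x`. -/
theorem KForm.pullback_eq_of_frequently (hη : η.IsSmooth)
    (hf : ∀ᶠ z in 𝓝 x, ContMDiffAt 𝓘(ℝ, E) 𝓘(ℝ, E) ∞ f z)
    (h : ∃ᶠ z in 𝓝 x, η.pullback f z = η z) : η.pullback f x = η x := by
  have hx := mem_extChartAt_source (I := 𝓘(ℝ, E)) x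
  have hfx := mem_extChartAt_source (I := 𝓘(ℝ, E)) (f x)
  have hev := eventually_mem_charts_and_contMDiffAt hf hx hfx
  have he : (η.pullback f).inChart x =ᶠ[𝓝 (extChartAt 𝓘(ℝ, E) x x)] fun y =>
      (η.inChart (f x) (mapInCharts E f x (f x) y)).compContinuousLinearMap
        (fderiv ℝ (mapInCharts E f x (f x)) y) := by
    filter_upwards [hev] with y hy
    exact η.inChart_pullback hy.1 hy.2.1 hy.2.2
  obtain ⟨h1, h2, h3⟩ := hev.self_of_nhds
  have hg := contDiffAt_mapInCharts h1 h2 h3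
  have hgx : mapInCharts E f x (f x) (extChartAt 𝓘(ℝ, E) x x) ∈
      (extChartAt 𝓘(ℝ, E) (f x)).target := (extChartAt 𝓘(ℝ, E) (f x)).map_source h3
  have hc1 : ContinuousAt ((η.pullback f).inChart x) (extChartAt 𝓘(ℝ, E) x x) := by
    refine ContinuousAt.congr ?_ he.symm
    have hω := ((hη (f x)).continuousOn.continuousAt
      (extChartAt_target_mem_nhds_of_mem hgx)).comp hg.continuousAt
    have hA : ContinuousAt (fderiv ℝ (mapInCharts E f x (f x))) (extChartAt 𝓘(ℝ, E) x x) :=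
      (hg.fderiv_right (m := 0) (by simp)).continuousAt
    exact ContinuousAt.clm_apply
      (ContinuousAlternatingMap.continuous_compContinuousLinearMapCLM.continuousAt.comp hA) hω
  have hc2 : ContinuousAt (η.inChart x) (extChartAt 𝓘(ℝ, E) x x) :=
    (hη x).continuousOn.continuousAt (extChartAt_target_mem_nhds_of_mem h1)
  have hfr : ∃ᶠ y in 𝓝 (extChartAt 𝓘(ℝ, E) x x), (η.pullback f).inChart x y = η.inChart x y := by
    have hq := (contMDiffAt_extChartAt_of_mem hx).continuousAt.tendsto.frequently
      (p := fun y => (η.pullback f).inChart x y = η.inChart x y)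
    refine hq ((h.and_eventually (extChartAt_source_mem_nhds (I := 𝓘(ℝ, E)) x)).mono ?_)
    rintro z ⟨hz, hzs⟩
    rw [KForm.inChart_eq, KForm.inChart_eq, (extChartAt 𝓘(ℝ, E) x).left_inv hzs]
    exact congrArg (fun a : E [⋀^Fin k]→L[ℝ] ℝ => a.compContinuousLinearMap _) hz
  -- Both chart expressions are continuous at the point, with values in a Hausdorff space, so
  -- agreement arbitrarily close to it forces agreement there.
  have heq := tendsto_nhds_unique_of_frequently_eq hc1.tendsto hc2.tendsto hfr
  change (η.pullback f).at x = η.at x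
  rw [KForm.at_eq_inChart _ hx, heq, ← KForm.at_eq_inChart _ hx]

omit [IsManifold 𝓘(ℝ, E) ∞ M] in
theorem KForm.contract_at (X : ∀ x : M, TangentSpace 𝓘(ℝ, E) x) (η : KForm E M (k + 1)) (x : M) :
    (η.contract X).at x = (η.at x).curryLeft (vectorAt X x) := rfl

/-- The trivialization of the tangent bundle at `x₀` acts on fibres by the derivative of the chart,
so this is the smooth section `X` read in that trivialization. -/
theorem contDiffOn_chartDeriv_vectorAt {X : ∀ x : M, TangentSpace 𝓘(ℝ, E) x}
    (hX : ContMDiff 𝓘(ℝ, E) 𝓘(ℝ, E).tangent ∞ (fun x => (⟨x, X x⟩ : TangentBundle 𝓘(ℝ, E) M)))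
    (x₀ : M) :
    ContDiffOn ℝ ∞ (fun y => chartDeriv x₀ ((extChartAt 𝓘(ℝ, E) x₀).symm y)
      (vectorAt X ((extChartAt 𝓘(ℝ, E) x₀).symm y))) (extChartAt 𝓘(ℝ, E) x₀).target := by
  have : IsManifold 𝓘(ℝ, E) 1 M := IsManifold.of_le (n := ∞) (by norm_num)
  have h := (Bundle.Trivialization.contMDiffOn_section_baseSet_iff
    (trivializationAt E (TangentSpace 𝓘(ℝ, E)) x₀)).1 (hX.contMDiffOn (s := _))
  have hmap : MapsTo (extChartAt 𝓘(ℝ, E) x₀).symm (extChartAt 𝓘(ℝ, E) x₀).target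
      (chartAt E x₀).source := fun y hy => by
    rw [← extChartAt_source 𝓘(ℝ, E)]
    exact (extChartAt 𝓘(ℝ, E) x₀).map_target hy
  refine (h.comp (contMDiffOn_extChartAt_symm x₀) hmap).contDiffOn.congr fun y hy => ?_
  have h1 := TangentBundle.continuousLinearMapAt_trivializationAt (I := 𝓘(ℝ, E)) (hmap hy)
  have h2 := Bundle.Trivialization.coe_linearMapAt_of_mem (R := ℝ)
    (trivializationAt E (TangentSpace 𝓘(ℝ, E)) x₀) (hmap hy)
  exact (congrArg (fun A : E →L[ℝ] E => A (vectorAt X _)) h1).symm.trans (congrFun h2 (X _))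

theorem KForm.IsSmooth.contract [FiniteDimensional ℝ E] {X : ∀ x : M, TangentSpace 𝓘(ℝ, E) x}
    (hX : ContMDiff 𝓘(ℝ, E) 𝓘(ℝ, E).tangent ∞ (fun x => (⟨x, X x⟩ : TangentBundle 𝓘(ℝ, E) M)))
    {η : KForm E M (k + 1)} (hη : η.IsSmooth) : (η.contract X).IsSmooth := fun x₀ => by
  refine ((hη x₀).curryLeft_apply (contDiffOn_chartDeriv_vectorAt hX x₀)).congr fun y hy => ?_
  have h := chartSymmDeriv_chartDeriv ((extChartAt 𝓘(ℝ, E) x₀).map_target hy)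
  rw [(extChartAt 𝓘(ℝ, E) x₀).right_inv hy] at h
  rw [KForm.inChart_eq, KForm.inChart_eq, KForm.contract_at,
    ContinuousAlternatingMap.curryLeft_compContinuousLinearMap, h]

end ChartExpression

/-! ### Hybrid trajectories, and the hybrid flow near regular points. -/

namespace HybridSystem

variable {E F M : Type*} [NormedAddCommGroup E] [NormedSpace ℝ E]
  [NormedAddCommGroup F] [NormedSpace ℝ F]
  [TopologicalSpace M] [ChartedSpace E M] [IsManifold 𝓘(ℝ, E) ∞ M]
  {H : HybridSystem E F M}

theorem FlowsTo.nonneg {x y : M} {t : ℝ} (h : H.FlowsTo x t y) : 0 ≤ t := h.1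

theorem Reaches.nonneg {x y : M} {t : ℝ} (h : H.Reaches x t y) : 0 ≤ t := by
  cases h with
  | flow h => exact h.nonneg
  | impact h hs _ => exact add_nonneg h.nonneg hs.le

/-- Recentres the integral curve at time `t`. As `t < T` is strict, the position at time `t` is not
an impact point. -/
theorem FlowsTo.exists_extension {x y : M} {t T : ℝ} (h : H.FlowsTo x T y) (ht : 0 ≤ t)
    (htT : t < T) : ∃ γ : ℝ → M, IsMIntegralCurveAt γ H.X 0 ∧ H.FlowsTo x t (γ 0) ∧ γ 0 ∉ H.S ∧
      ∀ s ∈ Ico 0 (T - t), H.FlowsTo x (t + s) (γ s) := by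
  obtain ⟨-, γ, a, b, ha, hb, hγ, h0, -, hS⟩ := h
  have hsub : ∀ s ∈ Ico 0 (T - t), H.FlowsTo x (t + s) (γ (s + t)) := fun s hs =>
    ⟨add_nonneg ht hs.1, γ, a, b, ha, by linarith [hs.2], hγ, h0, by rw [add_comm],
      fun u hu => hS u ⟨hu.1, by linarith [hu.2, hs.2]⟩⟩
  refine ⟨fun s => γ (s + t), ?_, ?_, ?_, hsub⟩
  · have h1 : IsMIntegralCurveAt γ H.X t :=
      hγ.isMIntegralCurveAt (Ioo_mem_nhds (by linarith) (by linarith))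
    have h2 := h1.comp_add t
    rwa [sub_self] at h2
  · simpa using hsub 0 ⟨le_rfl, by linarith⟩
  · simpa using hS t ⟨ht, htT⟩

/-- Just after a time at which a hybrid trajectory is outside `S`, it follows the flow of `X`. -/
theorem Reaches.exists_extension [T2Space M] {x y y₀ : M} {t T : ℝ} (h : H.Reaches x T y)
    (h₀ : H.Reaches x t y₀) (htT : t < T) (hy₀ : y₀ ∉ H.S) :
    ∃ γ : ℝ → M, ∃ δ > 0, IsMIntegralCurveAt γ H.X 0 ∧ γ 0 = y₀ ∧
      ∀ s ∈ Ico 0 δ, H.Reaches x (t + s) (γ s) := by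
  induction h generalizing t with
  | @flow x T y h =>
    obtain ⟨γ, hγ, hxt, -, hs⟩ := h.exists_extension h₀.nonneg htT
    exact ⟨γ, T - t, by linarith, hγ, (Reaches.flow hxt).unique h₀, fun s h' => .flow (hs s h')⟩
  | @impact x t₁ z s₁ y h hs₁ hr ih =>
    rcases lt_trichotomy t t₁ with hlt | rfl | hgt
    · obtain ⟨γ, hγ, hxt, -, hs⟩ := h.exists_extension h₀.nonneg hlt
      exact ⟨γ, t₁ - t, by linarith, hγ, (Reaches.flow hxt).unique h₀, fun s h' => .flow (hs s h')⟩
    -- At the impact time itself the position is still `z`, which lies in `S`.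
    · exact absurd ((Reaches.flow h).unique h₀ ▸ z.2) hy₀
    · cases h₀ with
      | flow h' => exact absurd (h.le_of_mem z.2 h') (not_le.2 hgt)
      | @impact _ t' z' s' _ h' hs' hr' =>
        obtain rfl : t₁ = t' := le_antisymm (h'.le_of_mem z'.2 h) (h.le_of_mem z.2 h')
        obtain rfl : z = z' := Subtype.ext (h.unique h')
        obtain ⟨γ, δ, hδ, hγ, hγ0, hs⟩ := ih hr' (by linarith)
        refine ⟨γ, δ, hδ, hγ, hγ0, fun s h1 => ?_⟩
        rw [add_assoc]
        exact .impact h (by linarith [h1.1]) (hs s h1)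

/-- The times at which a hybrid trajectory is in `S` contain no interval. -/
theorem Reaches.exists_not_mem {x y : M} {t T : ℝ} (h : H.Reaches x T y) (ht : 0 ≤ t)
    (htT : t < T) : ∃ t' ∈ Ioo t T, ∃ y' ∉ H.S, H.Reaches x t' y' := by
  have flow_case : ∀ {x y : M} {t T : ℝ}, H.FlowsTo x T y → 0 ≤ t → t < T →
      ∃ t' ∈ Ioo t T, ∃ y' ∉ H.S, H.Reaches x t' y' := by
    intro x y t T h ht htT
    obtain ⟨γ, -, hf, hS, -⟩ := h.exists_extension (t := (t + T) / 2) (by linarith) (by linarith)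
    exact ⟨(t + T) / 2, ⟨by linarith, by linarith⟩, γ 0, hS, .flow hf⟩
  induction h generalizing t with
  | flow h => exact flow_case h ht htT
  | @impact x t₁ z s₁ y h hs₁ hr ih =>
    rcases lt_or_ge t t₁ with hlt | hge
    · obtain ⟨t', ht', y', hy', hr'⟩ := flow_case h ht hlt
      exact ⟨t', ⟨ht'.1, by linarith [ht'.2]⟩, y', hy', hr'⟩
    -- The clock restarts at `Δ z`. The case `t = t₁` belongs here, with new starting time `0`.
    · obtain ⟨t', ht', y', hy', hr'⟩ := ih (t := t - t₁) (by linarith) (by linarith)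
      exact ⟨t₁ + t', ⟨by linarith [ht'.1], by linarith [ht'.2]⟩, y', hy',
        .impact h (by linarith [ht'.1]) hr'⟩

theorem FlowsTo.trans {x y z : M} {s t : ℝ} (h : H.FlowsTo x s y) (h' : H.FlowsTo y t z)
    [T2Space M] : H.FlowsTo x (s + t) z := by
  have : IsManifold 𝓘(ℝ, E) 1 M := IsManifold.of_le (n := ∞) (by norm_num)
  have hX : ContMDiff 𝓘(ℝ, E) 𝓘(ℝ, E).tangent 1
      (fun x => (⟨x, H.X x⟩ : TangentBundle 𝓘(ℝ, E) M)) := H.smooth_X.of_le (by norm_num)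
  obtain ⟨hs, γ, a, b, ha, hb, hγ, h0, hy, hS⟩ := h
  obtain ⟨ht, γ', a', b', ha', hb', hγ', h0', hz, hS'⟩ := h'
  have hγs : IsMIntegralCurveOn (γ' ∘ (· + -s)) H.X (Ioo (s + a') (s + b')) := by
    have := hγ'.comp_add (-s)
    refine this.mono fun u hu => ?_
    simp only [mem_ofPred_eq, mem_Ioo] at hu ⊢
    constructor <;> linarith [hu.1, hu.2]
  have hst : s ∈ Ioo a b ∩ Ioo (s + a') (s + b') :=
    ⟨⟨by linarith, hb⟩, ⟨by linarith, by linarith⟩⟩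
  have heq : γ s = (γ' ∘ (· + -s)) s := by simp [hy, h0']
  -- The glued curve is `γ` on `(a, b)` by construction; by uniqueness of integral curves it is also
  -- the shifted `γ'` on all of its interval.
  have hE := eqOn_piecewise_of_isMIntegralCurveOn_Ioo hX hγ hγs hst heq
  have hpw := isMIntegralCurveOn_piecewise hX hγ hγs hst heq
  have hE' : ∀ u ∈ Ioo a b, (Ioo a b).piecewise γ (γ' ∘ (· + -s)) u = γ u := fun u hu =>
    piecewise_eq_of_mem _ _ _ hu
  refine ⟨add_nonneg hs ht, (Ioo a b).piecewise γ (γ' ∘ (· + -s)), a, s + b', ha, by linarith,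
    hpw.mono ?_, ?_, ?_, ?_⟩
  · intro u hu
    rcases lt_or_ge u b with h1 | h1
    · exact .inl ⟨hu.1, h1⟩
    · exact .inr ⟨by linarith, hu.2⟩
  · rw [hE' 0 ⟨ha, by linarith⟩, h0]
  · rw [hE ⟨by linarith, by linarith⟩]
    simp [hz]
  · intro u hu
    rcases lt_or_ge u s with h1 | h1
    · rw [hE' u ⟨by linarith [hu.1], by linarith⟩]
      exact hS u ⟨hu.1, h1⟩
    · rw [hE ⟨by linarith, by linarith [hu.2]⟩]
      exact hS' (u + -s) ⟨by linarith, by linarith [hu.2]⟩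

/-- Only the arc before the first impact gets longer; the rest of the trajectory is unchanged. -/
theorem Reaches.of_flowsTo [T2Space M] {x y z : M} {s t : ℝ} (h : H.FlowsTo x s y)
    (h' : H.Reaches y t z) : H.Reaches x (s + t) z := by
  cases h' with
  | flow h' => exact .flow (h.trans h')
  | impact h' hs hr =>
    rw [← add_assoc]
    exact .impact (h.trans h') hs hr

theorem reaches_hybridFlow {x : M} {t : ℝ} (h : x ∈ H.flowDomain t) :
    H.Reaches x t (H.hybridFlow t x) := by
  have hex : ∃ y, H.Reaches x t y := h
  rw [hybridFlow, dif_pos hex]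
  exact hex.choose_spec

/-- A trajectory of `X` starting in an open set disjoint from `S` stays there for a short time. -/
theorem exists_flow_in_open [CompleteSpace E] (H : HybridSystem E F M) {U : Set M} (hU : IsOpen U)
    (hUS : U ∩ H.S = ∅) {x : M} (hx : x ∈ U) :
    ∃ γ : ℝ → M, ∃ δ > 0, IsMIntegralCurveAt γ H.X 0 ∧ γ 0 = x ∧
      ∀ s ∈ Ico 0 δ, γ s ∈ U ∧ H.FlowsTo x s (γ s) := by
  have : IsManifold 𝓘(ℝ, E) 1 M := IsManifold.of_le (n := ∞) (by norm_num)
  obtain ⟨γ, h0, hγ⟩ := exists_isMIntegralCurveAt_of_contMDiffAt_boundaryless (t₀ := 0)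
    ((H.smooth_X.of_le (by norm_num)).contMDiffAt (x := x))
  obtain ⟨ε, hε, hγε⟩ := isMIntegralCurveAt_iff'.1 hγ
  have hUγ : γ ⁻¹' U ∈ 𝓝 (0 : ℝ) := hγ.continuousAt (hU.mem_nhds (by rwa [h0]))
  obtain ⟨ε', hε', hb⟩ := Metric.mem_nhds_iff.1 hUγ
  rw [Real.ball_eq_Ioo] at hγε hb
  refine ⟨γ, min ε ε', lt_min hε hε', hγ, h0, fun s hs => ?_⟩
  have hsU : ∀ u ∈ Icc 0 s, γ u ∈ U := fun u hu =>
    hb ⟨by linarith [hu.1], by linarith [hu.2, hs.2, min_le_right ε ε']⟩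
  refine ⟨hsU s ⟨hs.1, le_rfl⟩, hs.1, γ, 0 - ε, 0 + ε, by linarith,
    by linarith [hs.2, min_le_left ε ε'], hγε, h0, rfl, fun u hu hS => ?_⟩
  exact (hUS ▸ ⟨hsU u ⟨hu.1, hu.2.le⟩, hS⟩ : γ u ∈ (∅ : Set M))

variable [T2Space M]

/-- The hybrid flow does not carry a nonempty open set disjoint from `S` into `S`. -/
theorem exists_hybridFlow_not_mem [CompleteSpace E] {U : Set M} {t : ℝ} (hU : IsOpen U)
    (hUS : U ∩ H.S = ∅) (hUt : U ⊆ H.flowDomain t) (hne : U.Nonempty) :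
    ∃ x ∈ U, H.hybridFlow t x ∉ H.S := by
  obtain ⟨x, hx⟩ := hne
  obtain ⟨γ, δ, hδ, -, -, hγ⟩ := H.exists_flow_in_open hU hUS hx
  by_contra! hS
  -- Moving the initial point along `X` for time `s` is the same as waiting `s` longer. So if `φ_t`
  -- sent all of `U` into `S`, the trajectory of `x` would lie in `S` throughout `[t, t + δ)`.
  have hr : ∀ s ∈ Ico 0 δ, H.Reaches x (s + t) (H.hybridFlow t (γ s)) := fun s hs =>
    Reaches.of_flowsTo (hγ s hs).2 (reaches_hybridFlow (hUt (hγ s hs).1))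
  have ht : 0 ≤ t := (reaches_hybridFlow (hUt hx)).nonneg
  obtain ⟨t', ht', y, hy, hry⟩ := (hr (δ / 2) ⟨by linarith, by linarith⟩).exists_not_mem ht
    (by linarith)
  have hs : t' - t ∈ Ico 0 δ := ⟨by linarith [ht'.1], by linarith [ht'.2]⟩
  have h1 := hr _ hs
  rw [sub_add_cancel] at h1
  exact hy (hry.unique h1 ▸ hS _ (hγ _ hs).1)

omit [T2Space M] in
theorem isRegularAt_of_mem {U : Set M} {t : ℝ} {x : M} (hU : IsOpen U) (hUS : U ∩ H.S = ∅)
    (hUt : U ⊆ H.flowDomain t)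
    (hsm : ContMDiffOn 𝓘(ℝ, E) 𝓘(ℝ, E) ∞ (H.hybridFlow t) U) (hx : x ∈ U)
    (hφ : H.hybridFlow t x ∉ H.S) : H.IsRegularAt t x :=
  ⟨fun h => (hUS ▸ ⟨hx, h⟩ : x ∈ (∅ : Set M)), hφ, U, hU, hx, hUS, hUt, hsm⟩

/-- Near a point at which the hybrid flow is regular, invariant forms agree with their pullback,
also at the points which are mapped to `S`. -/
theorem IsRegularAt.eventually_pullback_eq [FiniteDimensional ℝ E] {t : ℝ} {x : M}
    (hx : H.IsRegularAt t x) {α : MixedForm E M} (hα : α ∈ H.invariantForms) (k : ℕ) :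
    ∀ᶠ z in 𝓝 x, (α k).pullback (H.hybridFlow t) z = α k z := by
  have : CompleteSpace E := FiniteDimensional.complete ℝ E
  obtain ⟨-, -, U, hU, hxU, hUS, hUt, hsm⟩ := hx
  filter_upwards [hU.mem_nhds hxU] with z hz
  -- Invariance is not assumed at `z` if it is mapped into `S`, but every neighbourhood of `z`
  -- contains a point of `U` that is not.
  refine KForm.pullback_eq_of_frequently (hα.1 k) ?_ ?_
  · filter_upwards [hU.mem_nhds hz] with w hw
    exact hsm.contMDiffAt (hU.mem_nhds hw)
  · rw [Filter.frequently_iff]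
    intro V hV
    obtain ⟨W, hWV, hW, hzW⟩ := mem_nhds_iff.1 hV
    obtain ⟨w, hw, hwS⟩ := exists_hybridFlow_not_mem (t := t) (hW.inter hU)
      (subset_empty_iff.1 (hUS ▸ inter_subset_inter_left _ inter_subset_right))
      (inter_subset_right.trans hUt) ⟨z, hzW, hz⟩
    exact ⟨w, hWV hw.1, hα.2 t w (isRegularAt_of_mem hU hUS hUt hsm hw.2 hwS) k⟩

omit [T2Space M] in
theorem IsRegularAt.eventually_contMDiffAt {t : ℝ} {x : M} (hx : H.IsRegularAt t x) :
    ∀ᶠ z in 𝓝 x, ContMDiffAt 𝓘(ℝ, E) 𝓘(ℝ, E) ∞ (H.hybridFlow t) z := by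
  obtain ⟨-, -, U, hU, hxU, -, -, hsm⟩ := hx
  filter_upwards [hU.mem_nhds hxU] with w hw
  exact hsm.contMDiffAt (hU.mem_nhds hw)

/-- The vector field `X` is invariant under the hybrid flow. -/
theorem IsRegularAt.mapDeriv_hybridFlow_X [CompleteSpace E] {t : ℝ} {x : M}
    (hx : H.IsRegularAt t x) :
    mapDeriv (H.hybridFlow t) x (vectorAt H.X x) = vectorAt H.X (H.hybridFlow t x) := by
  have hsm := hx.eventually_contMDiffAt.self_of_nhds
  obtain ⟨-, hφ, U, hU, hxU, hUS, hUt, -⟩ := hx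
  obtain ⟨c, δ, hδ, hc, hc0, hcU⟩ := H.exists_flow_in_open hU hUS hxU
  have hr : ∀ s ∈ Ico 0 δ, H.Reaches x (t + s) (H.hybridFlow t (c s)) := fun s hs => by
    rw [add_comm]
    exact Reaches.of_flowsTo (hcU s hs).2 (reaches_hybridFlow (hUt (hcU s hs).1))
  -- Here `hφ` matters: from a point of `S` the trajectory would jump instead of following `X`.
  obtain ⟨γ, δ', hδ', hγ, hγ0, hγs⟩ := (hr (δ / 2) ⟨by linarith, by linarith⟩).exists_extension
    (reaches_hybridFlow (hUt hxU)) (by linarith) hφ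
  have heq : ∀ s ∈ Ico 0 (min δ δ'), H.hybridFlow t (c s) = γ s := fun s hs =>
    (hr s ⟨hs.1, hs.2.trans_le (min_le_left _ _)⟩).unique
      (hγs s ⟨hs.1, hs.2.trans_le (min_le_right _ _)⟩)
  subst hc0
  -- Trajectories run forward only, so the two curves are known to agree just for `s ≥ 0`.
  -- Derivatives within `Ici 0` are still unique.
  have h1 := ((hsm.mdifferentiableAt (by simp)).hasMFDerivAt.comp (0 : ℝ)
    hc.hasMFDerivAt).hasMFDerivWithinAt (s := Ici 0)
  have h2 := hγ.hasMFDerivAt.hasMFDerivWithinAt (s := Ici 0)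
  have h3 : γ =ᶠ[𝓝[Ici 0] (0 : ℝ)] H.hybridFlow t ∘ c := by
    filter_upwards [Ico_mem_nhdsGE (lt_min hδ hδ')] with s hs
    exact (heq s hs).symm
  have h4 := h1.congr_of_eventuallyEq h3 hγ0
  have hu : UniqueMDiffWithinAt 𝓘(ℝ, ℝ) (Ici (0 : ℝ)) 0 :=
    (uniqueDiffOn_Ici (0 : ℝ) 0 self_mem_Ici).uniqueMDiffWithinAt
  have h5 := congrArg (fun A : ℝ →L[ℝ] E => A 1) (hu.eq h4 h2)
  have e : ∀ p, ((1 : ℝ →L[ℝ] ℝ).smulRight (vectorAt H.X p)) 1 = vectorAt H.X p := by simp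
  rw [← hγ0]
  exact (congrArg (mapDeriv (H.hybridFlow t) (c 0)) (e _).symm).trans (h5.trans (e _))

end HybridSystem

/-! ### Mixed forms at a point, and closure properties of smooth forms. -/

section FormAlgebra

variable {E : Type*} [NormedAddCommGroup E] [NormedSpace ℝ E]
  {M : Type*} [TopologicalSpace M] [ChartedSpace E M] {k : ℕ} {α β : MixedForm E M} {f : M → M}
  {x : M}

theorem KForm.pullback_eq_iff {η : KForm E M k} :
    η.pullback f x = η x ↔ (η.at (f x)).compContinuousLinearMap (mapDeriv f x) = η.at x := Iff.rfl

theorem MixedForm.add_at (α β : MixedForm E M) (k : ℕ) (x : M) :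
    KForm.at ((α + β) k) x = KForm.at (α k) x + KForm.at (β k) x := rfl

theorem MixedForm.smul_at (c : ℝ) (α : MixedForm E M) (k : ℕ) (x : M) :
    KForm.at ((c • α) k) x = c • KForm.at (α k) x := rfl

theorem MixedForm.wedge_at (α β : MixedForm E M) (m : ℕ) (x : M) :
    KForm.at (α.wedge β m) x = ∑ p : Finset.HasAntidiagonal.antidiagonal m,
      _root_.wedge (Finset.HasAntidiagonal.mem_antidiagonal.mp p.2) (KForm.at (α p.1.1) x)
        (KForm.at (β p.1.2) x) := rfl

theorem MixedForm.one_at_succ (k : ℕ) (x : M) :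
    KForm.at (MixedForm.one (E := E) (k + 1)) x = 0 := rfl

theorem sum_compContinuousLinearMap {V W ι : Type*} [NormedAddCommGroup V] [NormedSpace ℝ V]
    [NormedAddCommGroup W] [NormedSpace ℝ W] (s : Finset ι) (a : ι → V [⋀^Fin k]→L[ℝ] ℝ)
    (A : W →L[ℝ] V) :
    (∑ i ∈ s, a i).compContinuousLinearMap A = ∑ i ∈ s, (a i).compContinuousLinearMap A :=
  map_sum (ContinuousAlternatingMap.compContinuousLinearMapCLM A) a s

theorem KForm.IsSmooth.zero : (0 : KForm E M k).IsSmooth := fun _ =>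
  (contDiffOn_const (c := (0 : E [⋀^Fin k]→L[ℝ] ℝ))).congr fun _ _ => rfl

theorem MixedForm.one_mem_smoothForms : MixedForm.one ∈ MixedForm.smoothForms E M
  | 0 => fun _ => (contDiffOn_const
      (c := ContinuousAlternatingMap.constOfIsEmpty ℝ E (Fin 0) (1 : ℝ))).congr fun _ _ => rfl
  | _ + 1 => KForm.IsSmooth.zero

theorem MixedForm.add_mem_smoothForms (hα : α ∈ MixedForm.smoothForms E M)
    (hβ : β ∈ MixedForm.smoothForms E M) : α + β ∈ MixedForm.smoothForms E M := fun k x₀ =>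
  ((hα k x₀).add (hβ k x₀)).congr fun _ _ => rfl

theorem MixedForm.smul_mem_smoothForms (c : ℝ) (hα : α ∈ MixedForm.smoothForms E M) :
    c • α ∈ MixedForm.smoothForms E M := fun k x₀ =>
  ((hα k x₀).const_smul c).congr fun _ _ => rfl

theorem MixedForm.wedge_mem_smoothForms [FiniteDimensional ℝ E]
    (hα : α ∈ MixedForm.smoothForms E M) (hβ : β ∈ MixedForm.smoothForms E M) :
    α.wedge β ∈ MixedForm.smoothForms E M := fun m x₀ => by
  refine (ContDiffOn.sum (s := Finset.univ) fun (p : Finset.HasAntidiagonal.antidiagonal m) _ =>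
    (hα p.1.1 x₀).wedge (Finset.HasAntidiagonal.mem_antidiagonal.mp p.2)
      (hβ p.1.2 x₀)).congr fun y _ => ?_
  rw [KForm.inChart_eq, MixedForm.wedge_at, sum_compContinuousLinearMap]
  exact Finset.sum_congr rfl fun p _ => wedge_compContinuousLinearMap _ _ _ _

theorem MixedForm.d_mem_smoothForms [IsManifold 𝓘(ℝ, E) ∞ M]
    (hα : α ∈ MixedForm.smoothForms E M) : α.d ∈ MixedForm.smoothForms E M
  | 0 => KForm.IsSmooth.zero
  | k + 1 => (hα k).d

end FormAlgebra

/-! ### Closure properties of invariant forms. -/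

namespace HybridSystem

variable {E F M : Type*} [NormedAddCommGroup E] [NormedSpace ℝ E]
  [NormedAddCommGroup F] [NormedSpace ℝ F]
  [TopologicalSpace M] [ChartedSpace E M] [IsManifold 𝓘(ℝ, E) ∞ M]
  {H : HybridSystem E F M} {α β : MixedForm E M}

theorem one_mem_invariantForms : MixedForm.one ∈ H.invariantForms := by
  refine ⟨MixedForm.one_mem_smoothForms, fun t x _ k => ?_⟩
  rw [KForm.pullback_eq_iff]
  cases k with
  | zero => rfl
  | succ k => rw [MixedForm.one_at_succ, MixedForm.one_at_succ]; rfl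

theorem add_mem_invariantForms (hα : α ∈ H.invariantForms) (hβ : β ∈ H.invariantForms) :
    α + β ∈ H.invariantForms := by
  refine ⟨MixedForm.add_mem_smoothForms hα.1 hβ.1, fun t x hx k => ?_⟩
  rw [KForm.pullback_eq_iff, MixedForm.add_at, MixedForm.add_at,
    ← KForm.pullback_eq_iff.1 (hα.2 t x hx k), ← KForm.pullback_eq_iff.1 (hβ.2 t x hx k)]
  rfl

theorem smul_mem_invariantForms (c : ℝ) (hα : α ∈ H.invariantForms) :
    c • α ∈ H.invariantForms := by
  refine ⟨MixedForm.smul_mem_smoothForms c hα.1, fun t x hx k => ?_⟩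
  rw [KForm.pullback_eq_iff, MixedForm.smul_at, MixedForm.smul_at,
    ← KForm.pullback_eq_iff.1 (hα.2 t x hx k)]
  rfl

theorem wedge_mem_invariantForms [FiniteDimensional ℝ E] (hα : α ∈ H.invariantForms)
    (hβ : β ∈ H.invariantForms) : α.wedge β ∈ H.invariantForms := by
  refine ⟨MixedForm.wedge_mem_smoothForms hα.1 hβ.1, fun t x hx k => ?_⟩
  rw [KForm.pullback_eq_iff, MixedForm.wedge_at, MixedForm.wedge_at, sum_compContinuousLinearMap]
  refine Finset.sum_congr rfl fun p _ => ?_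
  rw [wedge_compContinuousLinearMap, KForm.pullback_eq_iff.1 (hα.2 t x hx _),
    KForm.pullback_eq_iff.1 (hβ.2 t x hx _)]

variable [T2Space M] [FiniteDimensional ℝ E]

theorem d_mem_invariantForms (hα : α ∈ H.invariantForms) : α.d ∈ H.invariantForms := by
  refine ⟨MixedForm.d_mem_smoothForms hα.1, fun t x hx k => ?_⟩
  cases k with
  | zero => rfl
  | succ k =>
    -- `φ^*(dα) = d(φ^*α)`, and `φ^*α = α` holds on a neighbourhood of `x`, so locality of `d`
    -- applies.
    exact (KForm.d_pullback_at (hα.1 k) hx.eventually_contMDiffAt).symm.trans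
      (KForm.d_congr (hx.eventually_pullback_eq hα k))

theorem contract_mem_invariantForms (hα : α ∈ H.invariantForms) :
    MixedForm.contract H.X α ∈ H.invariantForms := by
  have : CompleteSpace E := FiniteDimensional.complete ℝ E
  refine ⟨fun k => (hα.1 (k + 1)).contract H.smooth_X, fun t x hx k => ?_⟩
  change KForm.pullback _ (KForm.contract H.X (α (k + 1))) x = KForm.contract H.X (α (k + 1)) x
  -- Since `X` at `φ_t(x)` is the image of `X` at `x`, pulling back the contraction equals
  -- contracting the pullback.
  rw [KForm.pullback_eq_iff, KForm.contract_at, KForm.contract_at, ← hx.mapDeriv_hybridFlow_X,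
    ← ContinuousAlternatingMap.curryLeft_compContinuousLinearMap,
    KForm.pullback_eq_iff.1 (hα.2 t x hx (k + 1))]

end HybridSystem

/-- For a smooth hybrid system, the hybrid-invariant differential forms are a unital subalgebra of
the algebra of differential forms under the exterior product, and they are closed under the
exterior derivative and under contraction with `X`. -/
theorem mainTheorem8 {E F M : Type*}
    [NormedAddCommGroup E] [NormedSpace ℝ E] [FiniteDimensional ℝ E]
    [NormedAddCommGroup F] [NormedSpace ℝ F] [FiniteDimensional ℝ F]
    [TopologicalSpace M] [T2Space M] [SecondCountableTopology M]
    [ChartedSpace E M] [IsManifold 𝓘(ℝ, E) ∞ M]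
    (H : HybridSystem E F M) (hH : H.IsSmooth) :
    MixedForm.one ∈ H.invariantForms ∧
    (∀ α ∈ H.invariantForms, ∀ β ∈ H.invariantForms, α + β ∈ H.invariantForms) ∧
    (∀ c : ℝ, ∀ α ∈ H.invariantForms, c • α ∈ H.invariantForms) ∧
    (∀ α ∈ H.invariantForms, ∀ β ∈ H.invariantForms, α.wedge β ∈ H.invariantForms) ∧
    (∀ α ∈ H.invariantForms, α.d ∈ H.invariantForms) ∧
    (∀ α ∈ H.invariantForms, MixedForm.contract H.X α ∈ H.invariantForms) :=
  ⟨HybridSystem.one_mem_invariantForms,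
    fun _ hα _ hβ => HybridSystem.add_mem_invariantForms hα hβ,
    fun c _ hα => HybridSystem.smul_mem_invariantForms c hα,
    fun _ hα _ hβ => HybridSystem.wedge_mem_invariantForms hα hβ,
    fun _ hα => HybridSystem.d_mem_invariantForms hα,
    fun _ hα => HybridSystem.contract_mem_invariantForms hα⟩
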